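/- Let $n\ge 2$, $\alpha=e^{2\pi i/n}$, $a=\mathrm{diag}(1,\alpha,\dots,\alpha^{n-1})$, $b=\sum_{i=1}^{n-1}e_{i,i+1}$, $J=a\lambda+b$, $\sigma_k=\frac{1-\alpha^k}{1-\alpha}$, $\Lambda=\sum_{k=1}^{n-1}\sigma_k e_{k+1,k}$ and $\phi_n(\lambda)=\sum_{i=0}^{n-1}\frac{1}{\sigma_1\cdots\sigma_i}\Lambda^i\lambda^i$. Let $L_-$ be the set of formal series $g(\lambda)=\mathrm I+\sum_{m\ge1}g_m\lambda^{-m}$, $g_m\in M_n(\mathbb C)$, with $\det g=1$ that satisfy the $n\times n$ KdV reality condition: $\phi_n(\lambda)g(\lambda)\phi_n(\lambda)^{-1}$ is a series in $\lambda^n$. For an open set $U\subset\mathbb R$ and smooth $u_1,\dots,u_{n-1}:U\to\mathbb C$ put $u=\sum_{j=1}^{n-1}u_j\Lambda^j$. A bare wave function of $\partial_x-(J+u)$ on $U$ is a map $M:U\to L_-$, with coefficients smooth in $x$, such that $M(\partial_x-J)M^{-1}=\partial_x-(J+u)$, i.e. $(\partial_xM)M^{-1}+MJM^{-1}=J+u$.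 Put $Q=MJM^{-1}$ and let $Q_{-j}$ denote the coefficient of $\lambda^{-j}$ in $Q$. A differential polynomial in $u$ is a polynomial with complex coefficients in the variables $\partial_x^r u_k$ ($1\le k\le n-1$, $r\ge0$). Assign the weights $$\nu(\lambda)=1,\qquad \nu(e_{ik})=k-i,\qquad \nu(\partial_x^r u_k)=r+k+1,\qquad \nu(\xi\eta)=\nu(\xi)+\nu(\eta).$$ Thus a matrix of differential polynomials has weight $w$ if, for all $i,k$, its $(i,k)$ entry is weighted homogeneous of weight $w-(k-i)$ (zero is homogeneous of every weight), and a Laurent series in $\lambda^{-1}$ with such matrices as coefficients has weight $w$ if for every integer $s$ its coefficient of $\lambda^{-s}$ has weight $w+s$. Theorem. For each $n\ge2$ there is a Laurent series $P$ in $\lambda^{-1}$, whose coefficients $P_{-j}$ (of $\lambda^{-j}$) are $n\times n$ matrices of differential polynomials in $u$, depending only on $n$, such that for every $U$, $u$ and bare wave function $M$ as above, $Q$ is obtained by evaluating $P$ on $u$ (that is, $Q_{-j}=P_{-j}(u)$ on $U$ for every integer $j$), and $Q^l$ is obtained by evaluating $P^l$ on $u$ for every integer $l\ge0$. Moreover: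 1. $P_{-j}$ has weight $j+1$ for every integer $j$; that is, $\nu(Q_{-j})=j+1$. 2. For $j\ge1$, the entries of $P_{-j}$ have no constant term; that is, the entries of $Q_{-j}$ are differential polynomials in $u$ without constant term. 3. For every $l\ge0$, $P^l$ has weight $l$; that is, $Q^l$ is a matrix of differential polynomials in $u$ of weight $l$. -/

import Mathlib

open scoped ContDiff

noncomputable section

namespace NKdV

/-- `α = exp(2πi/n)`. -/
def alpha (n : ℕ) : ℂ := Complex.exp (2 * Real.pi * Complex.I / n)

/-- `σ_k = (1 - α^k) / (1 - α)`. -/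
def sigma (n k : ℕ) : ℂ := (1 - alpha n ^ k) / (1 - alpha n)

/-- `a = diag(1, α, …, α^{n-1})`. -/
def matA (n : ℕ) : Matrix (Fin n) (Fin n) ℂ :=
  Matrix.diagonal fun i => alpha n ^ (i : ℕ)

/-- `b = e_{12} + e_{23} + ⋯ + e_{n-1,n}`. -/
def matB (n : ℕ) : Matrix (Fin n) (Fin n) ℂ :=
  Matrix.of fun i k => if (k : ℕ) = i + 1 then 1 else 0

/-- `Λ = ∑_{k=1}^{n-1} σ_k e_{k+1,k}` (rows and columns are numbered from `0` in `Fin n`). -/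
def matLambda (n : ℕ) : Matrix (Fin n) (Fin n) ℂ :=
  Matrix.of fun i k => if (i : ℕ) = k + 1 then sigma n i else 0

/-- `n × n` loops. A Laurent series in `λ⁻¹` is an element of `LaurentSeries R`,
whose local parameter is `λ⁻¹`: the coefficient of index `s` is that of `λ^{-s}`. -/
abbrev Loop (n : ℕ) (R : Type) [Zero R] : Type := Matrix (Fin n) (Fin n) (LaurentSeries R)

/-- The loop variable `λ`. -/
def lam : LaurentSeries ℂ := HahnSeries.single (-1) 1

/-- A constant matrix as a loop. -/
def constLoop {n : ℕ} (A : Matrix (Fin n) (Fin n) ℂ) : Loop n ℂ :=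
  A.map (HahnSeries.C (Γ := ℤ) (R := ℂ))

/-- A power series in `λ⁻¹` with matrix coefficients as a loop. -/
def toLoop {n : ℕ} (g : Matrix (Fin n) (Fin n) (PowerSeries ℂ)) : Loop n ℂ :=
  g.map (HahnSeries.ofPowerSeries ℤ ℂ)

/-- The matrix coefficient of `λ^{-s}` of a loop. -/
def coeffMat {n : ℕ} {R : Type} [Zero R] (B : Loop n R) (s : ℤ) : Matrix (Fin n) (Fin n) R :=
  Matrix.of fun i k => (B i k).coeff s

/-- `J = a λ + b`. -/
def J (n : ℕ) : Loop n ℂ := lam • constLoop (matA n) + constLoop (matB n)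

/-- `φ_n(λ) = ∑_{i=0}^{n-1} c_i Λ^i λ^i`, with `c_i = 1 / (σ_1 ⋯ σ_i)`. -/
def phi (n : ℕ) : Loop n ℂ :=
  ∑ i ∈ Finset.range n,
    lam ^ i • constLoop ((∏ k ∈ Finset.Icc 1 i, sigma n k)⁻¹ • matLambda n ^ i)

/-- The `n × n` KdV reality condition: `φ_n B φ_n⁻¹` is a series in `λ^n`. -/
def Reality {n : ℕ} (B : Loop n ℂ) : Prop :=
  ∀ s : ℤ, ¬ (n : ℤ) ∣ s → coeffMat (phi n * B * (phi n)⁻¹) s = 0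

/-- The negative group `L_-`: formal series `I + O(λ⁻¹)` of determinant one that satisfy the
`n × n` KdV reality condition. -/
structure InLMinus {n : ℕ} (g : Matrix (Fin n) (Fin n) (PowerSeries ℂ)) : Prop where
  at_infinity : g.map (PowerSeries.constantCoeff (R := ℂ)) = 1
  det_eq_one : g.det = 1
  reality : Reality (toLoop g)

/-- `u(x) = ∑_{j=1}^{n-1} u_j(x) Λ^j`; the function `u_j` is `u ⟨j - 1, _⟩`. -/
def uMat {n : ℕ} (u : Fin (n - 1) → ℝ → ℂ) (x : ℝ) : Matrix (Fin n) (Fin n) ℂ :=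
  ∑ k : Fin (n - 1), u k x • matLambda n ^ ((k : ℕ) + 1)

/-- The coefficientwise derivative `∂_x M`. -/
def dx {n : ℕ} (M : ℝ → Matrix (Fin n) (Fin n) (PowerSeries ℂ)) (x : ℝ) :
    Matrix (Fin n) (Fin n) (PowerSeries ℂ) :=
  Matrix.of fun i k => PowerSeries.mk fun m => deriv (fun y => PowerSeries.coeff m (M y i k)) x

/-- `M` is a bare wave function over `U` of `∂_x - (aλ + b + u)`: a smooth map with values in
`L_-` such that `M (∂_x - J) M⁻¹ = ∂_x - (J + u)`, that is `(∂_x M) M⁻¹ + M J M⁻¹ = J + u`. -/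
structure IsBareWave {n : ℕ} (U : Set ℝ) (u : Fin (n - 1) → ℝ → ℂ)
    (M : ℝ → Matrix (Fin n) (Fin n) (PowerSeries ℂ)) : Prop where
  smooth : ∀ i k m, ContDiffOn ℝ ∞ (fun x => PowerSeries.coeff m (M x i k)) U
  mem : ∀ x ∈ U, InLMinus (M x)
  gauge : ∀ x ∈ U,
    toLoop (dx M x) * (toLoop (M x))⁻¹ + toLoop (M x) * J n * (toLoop (M x))⁻¹
      = J n + constLoop (uMat u x)

/-- `Q = M J M⁻¹`. -/
def Q {n : ℕ} (M : ℝ → Matrix (Fin n) (Fin n) (PowerSeries ℂ)) (x : ℝ) : Loop n ℂ :=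
  toLoop (M x) * J n * (toLoop (M x))⁻¹

/-- Differential polynomials in `u_1, …, u_{n-1}`: the variable `(k, r)` stands for
`∂_x^r u_{k+1}`. -/
abbrev DiffPoly (n : ℕ) : Type := MvPolynomial (Fin (n - 1) × ℕ) ℂ

/-- The value at `x` of a differential polynomial on the functions `u_1, …, u_{n-1}`. -/
def evalAt {n : ℕ} (u : Fin (n - 1) → ℝ → ℂ) (x : ℝ) : DiffPoly n →ₐ[ℂ] ℂ :=
  MvPolynomial.aeval fun p => iteratedDeriv p.2 (u p.1) x

/-- The weight `ν(∂_x^r u_m) = r + m + 1`, where `m = k + 1`. -/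
def varWeight (n : ℕ) (p : Fin (n - 1) × ℕ) : ℤ := (p.2 : ℤ) + (((p.1 : ℕ) : ℤ) + 1) + 1

/-- A matrix of differential polynomials has weight `w`, where `ν(e_{ik}) = k - i`:
its `(i, k)` entry is homogeneous of weight `w - (k - i)`. -/
def MatHasWeight {n : ℕ} (P : Matrix (Fin n) (Fin n) (DiffPoly n)) (w : ℤ) : Prop :=
  ∀ i k, MvPolynomial.IsWeightedHomogeneous (varWeight n) (P i k)
    (w - (((k : ℕ) : ℤ) - ((i : ℕ) : ℤ)))

/-- A loop of matrices of differential polynomials has weight `w`, where `ν(λ) = 1`: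
the coefficient of `λ^{-s}` has weight `w + s`. -/
def LoopHasWeight {n : ℕ} (B : Loop n (DiffPoly n)) (w : ℤ) : Prop :=
  ∀ s : ℤ, MatHasWeight (coeffMat B s) (w + s)

end NKdV

end

/-! Put `W = λ⁻¹ Q = M (a + b λ⁻¹) M⁻¹`, a power series in `λ⁻¹`. Three facts determine it: its
leading coefficient is `a`; `W ^ n = 1`, since `a + b λ⁻¹` is triangular with the `n`-th roots of
unity on the diagonal; and the gauge equation gives the Lax equation `∂ₓ W_m = [a, W_{m+1}] + [b +
u, W_m]`. As `a` has distinct eigenvalues, the Lax equation yields the off-diagonal part of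
`W_{m+1}` by division. The diagonal part comes from `W ^ n = 1`, whose first variation in the entry
`(i, i)` has the nonzero factor `n a_i ^ (n - 1)`. No integration occurs, so this recursion can be
run on differential polynomials; its result is `symW`, and `psCoeff_eq_eval_symW` says that every
such `W` is an evaluation of it.

The weights follow because each step of the recursion is homogeneous (`matHasWeight_nextCoeff`). For
the constant terms, the same uniqueness lemma is applied to `u = 0` and `W = a + b λ⁻¹`, which has
no coefficients of index at least two (`constantCoeff_symW`). -/

noncomputable section

namespace NKdV

variable {n : ℕ}

/-! ### Matrices of power series, coefficient by coefficient -/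

section CoeffMatrix

variable {R : Type} [CommRing R]

/-- The matrix of `m`-th coefficients of a matrix of power series. -/
def psCoeff (m : ℕ) (B : Matrix (Fin n) (Fin n) (PowerSeries R)) : Matrix (Fin n) (Fin n) R :=
  B.map (PowerSeries.coeff m)

/-- A constant matrix as a matrix of power series. -/
def psConst (A : Matrix (Fin n) (Fin n) R) : Matrix (Fin n) (Fin n) (PowerSeries R) :=
  A.map (PowerSeries.C (R := R))

theorem psCoeff_ext {A B : Matrix (Fin n) (Fin n) (PowerSeries R)}
    (h : ∀ m, psCoeff m A = psCoeff m B) : A = B := by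
  ext i k m
  exact congrFun (congrFun (h m) i) k

@[simp] theorem psCoeff_add (m : ℕ) (A B : Matrix (Fin n) (Fin n) (PowerSeries R)) :
    psCoeff m (A + B) = psCoeff m A + psCoeff m B := by
  ext; simp [psCoeff]

@[simp] theorem psCoeff_sub (m : ℕ) (A B : Matrix (Fin n) (Fin n) (PowerSeries R)) :
    psCoeff m (A - B) = psCoeff m A - psCoeff m B := by
  ext; simp [psCoeff]

theorem psCoeff_zero (m : ℕ) :
    psCoeff m (0 : Matrix (Fin n) (Fin n) (PowerSeries R)) = 0 := by
  ext; simp [psCoeff]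

theorem psCoeff_mul (m : ℕ) (A B : Matrix (Fin n) (Fin n) (PowerSeries R)) :
    psCoeff m (A * B) = ∑ p ∈ Finset.HasAntidiagonal.antidiagonal m, psCoeff p.1 A * psCoeff p.2 B := by
  ext i k
  simp only [psCoeff, Matrix.map_apply, Matrix.mul_apply, map_sum, PowerSeries.coeff_mul,
    Matrix.sum_apply]
  exact Finset.sum_comm

theorem psCoeff_psConst (m : ℕ) (A : Matrix (Fin n) (Fin n) R) :
    psCoeff m (psConst A) = if m = 0 then A else 0 := by
  ext i k
  simp only [psCoeff, psConst, Matrix.map_apply, PowerSeries.coeff_C]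
  split_ifs <;> simp

theorem psCoeff_one (m : ℕ) :
    psCoeff m (1 : Matrix (Fin n) (Fin n) (PowerSeries R)) = if m = 0 then 1 else 0 := by
  rw [← psCoeff_psConst]
  congr 1
  simp [psConst]

theorem psCoeff_X_pow_smul (d m : ℕ) (A : Matrix (Fin n) (Fin n) (PowerSeries R)) :
    psCoeff m ((PowerSeries.X : PowerSeries R) ^ d • A)
      = if d ≤ m then psCoeff (m - d) A else 0 := by
  ext i k
  simp only [psCoeff, Matrix.map_apply, Matrix.smul_apply, smul_eq_mul, PowerSeries.coeff_X_pow_mul']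
  split_ifs <;> simp

theorem psCoeff_X_smul_zero (A : Matrix (Fin n) (Fin n) (PowerSeries R)) :
    psCoeff 0 ((PowerSeries.X : PowerSeries R) • A) = 0 := by
  simpa using psCoeff_X_pow_smul 1 0 A

theorem psCoeff_X_smul_succ (m : ℕ) (A : Matrix (Fin n) (Fin n) (PowerSeries R)) :
    psCoeff (m + 1) ((PowerSeries.X : PowerSeries R) • A) = psCoeff m A := by
  simpa using psCoeff_X_pow_smul 1 (m + 1) A

theorem psCoeff_psConst_mul (m : ℕ) (A : Matrix (Fin n) (Fin n) R)
    (B : Matrix (Fin n) (Fin n) (PowerSeries R)) :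
    psCoeff m (psConst A * B) = A * psCoeff m B := by
  rw [psCoeff_mul, Finset.sum_eq_single (0, m)]
  · simp [psCoeff_psConst]
  · rintro ⟨i, j⟩ hij hne
    have : i ≠ 0 := by
      rintro rfl
      simp_all
    simp [psCoeff_psConst, this]
  · simp

theorem psCoeff_mul_psConst (m : ℕ) (A : Matrix (Fin n) (Fin n) R)
    (B : Matrix (Fin n) (Fin n) (PowerSeries R)) :
    psCoeff m (B * psConst A) = psCoeff m B * A := by
  rw [psCoeff_mul, Finset.sum_eq_single (m, 0)]
  · simp [psCoeff_psConst]
  · rintro ⟨i, j⟩ hij hne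
    have : j ≠ 0 := by
      rintro rfl
      simp_all
    simp [psCoeff_psConst, this]
  · simp

/-- In the convolution a term with left index below `s` is zero, and `m ≤ s` leaves only the extreme
term. -/
theorem psCoeff_mul_of_vanish_left {s m : ℕ} {A B : Matrix (Fin n) (Fin n) (PowerSeries R)}
    (hA : ∀ i < s, psCoeff i A = 0) (hm : m ≤ s) :
    psCoeff m (A * B) = psCoeff m A * psCoeff 0 B := by
  rw [psCoeff_mul, Finset.sum_eq_single (m, 0)]
  · rintro ⟨i, j⟩ hij hne
    rw [Finset.HasAntidiagonal.mem_antidiagonal] at hij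
    have : i < s := by
      by_contra h
      exact hne (by ext <;> simp at * <;> omega)
    simp [hA i this]
  · simp

theorem psCoeff_mul_of_vanish_right {s m : ℕ} {A B : Matrix (Fin n) (Fin n) (PowerSeries R)}
    (hB : ∀ i < s, psCoeff i B = 0) (hm : m ≤ s) :
    psCoeff m (A * B) = psCoeff 0 A * psCoeff m B := by
  rw [psCoeff_mul, Finset.sum_eq_single (0, m)]
  · rintro ⟨i, j⟩ hij hne
    rw [Finset.HasAntidiagonal.mem_antidiagonal] at hij
    have : j < s := by
      by_contra h
      exact hne (by ext <;> simp at * <;> omega)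
    simp [hB j this]
  · simp

theorem psCoeff_pow_zero_eq_diagonal {d : Fin n → R}
    {A : Matrix (Fin n) (Fin n) (PowerSeries R)} (hA : psCoeff 0 A = Matrix.diagonal d) (k : ℕ) :
    psCoeff 0 (A ^ k) = Matrix.diagonal (d ^ k) := by
  induction k with
  | zero => simp [psCoeff_one]
  | succ k ih =>
    rw [pow_succ, psCoeff_mul]
    simp [ih, hA, pow_succ]

/-- The first variation of the diagonal of `A ^ k` when the leading coefficient of `A` is
diagonal. -/
theorem psCoeff_pow_sub_pow {s : ℕ} {d : Fin n → R}
    {A B : Matrix (Fin n) (Fin n) (PowerSeries R)}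
    (hA : psCoeff 0 A = Matrix.diagonal d) (hB : psCoeff 0 B = Matrix.diagonal d)
    (h : ∀ i < s, psCoeff i (A - B) = 0) (k : ℕ) :
    (∀ i < s, psCoeff i (A ^ k - B ^ k) = 0) ∧
      ∀ p, psCoeff s (A ^ k - B ^ k) p p = k * d p ^ (k - 1) * psCoeff s (A - B) p p := by
  induction k with
  | zero =>
    refine ⟨fun i _ => ?_, fun p => ?_⟩ <;> simp [psCoeff_zero]
  | succ k ih =>
    -- Telescoping keeps every factor in order, so `A` and `B` need not commute.
    have e : A ^ (k + 1) - B ^ (k + 1) = A ^ k * (A - B) + (A ^ k - B ^ k) * B := by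
      rw [pow_succ, pow_succ]; noncomm_ring
    have key : ∀ i ≤ s, psCoeff i (A ^ (k + 1) - B ^ (k + 1))
        = Matrix.diagonal (d ^ k) * psCoeff i (A - B)
          + psCoeff i (A ^ k - B ^ k) * Matrix.diagonal d := by
      intro i hi
      rw [e, psCoeff_add, psCoeff_mul_of_vanish_right h hi, psCoeff_mul_of_vanish_left ih.1 hi,
        hB, psCoeff_pow_zero_eq_diagonal hA]
    refine ⟨fun i hi => ?_, fun p => ?_⟩
    · rw [key i hi.le, h i hi, ih.1 i hi]; simp
    · rw [key s le_rfl, Matrix.add_apply, Matrix.diagonal_mul, Matrix.mul_diagonal, ih.2]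
      -- The exponent `k - 1` is truncated, so `k = 0` is separate; there the factor `k` kills the
      -- term.
      rcases k with _ | k
      · simp
      · simp only [Pi.pow_apply, Nat.add_sub_cancel]
        push_cast
        ring

theorem psCoeff_map {S : Type} [CommRing S] (f : R →+* S) (m : ℕ)
    (B : Matrix (Fin n) (Fin n) (PowerSeries R)) :
    psCoeff m (B.map (PowerSeries.map f)) = (psCoeff m B).map f := by
  ext; simp [psCoeff]

end CoeffMatrix

/-! ### From power series to Laurent series: multiplication by powers of `λ` -/

section Shift

variable {R : Type} [CommRing R]

/-- The loop `λ^l B(λ⁻¹)` of a matrix of power series `B`. -/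
def shiftLoop (l : ℕ) (B : Matrix (Fin n) (Fin n) (PowerSeries R)) : Loop n R :=
  (HahnSeries.single (-(l : ℤ)) 1 : LaurentSeries R) • B.map (HahnSeries.ofPowerSeries ℤ R)

theorem coeffMat_shiftLoop (l : ℕ) (B : Matrix (Fin n) (Fin n) (PowerSeries R)) (s : ℤ) :
    coeffMat (shiftLoop l B) s = if 0 ≤ s + l then psCoeff (s + l).toNat B else 0 := by
  ext i k
  have h : (coeffMat (shiftLoop l B) s) i k
      = (HahnSeries.ofPowerSeries ℤ R (B i k)).coeff (s + l) := by
    simp [coeffMat, shiftLoop, HahnSeries.coeff_single_mul]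
  rw [h]
  split_ifs with hs
  · lift s + l to ℕ using hs with m
    rw [HahnSeries.ofPowerSeries_apply_coeff]
    simp [psCoeff]
  · rw [HahnSeries.ofPowerSeries_apply, HahnSeries.embDomain_of_notMem_range]
    · simp
    · rintro ⟨m, hm⟩
      apply hs
      rw [← hm]
      simp

theorem shiftLoop_pow (B : Matrix (Fin n) (Fin n) (PowerSeries R)) (l : ℕ) :
    shiftLoop 1 B ^ l = shiftLoop l (B ^ l) := by
  have h : (B ^ l).map (HahnSeries.ofPowerSeries ℤ R) = B.map (HahnSeries.ofPowerSeries ℤ R) ^ l :=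
    map_pow (RingHom.mapMatrix (HahnSeries.ofPowerSeries ℤ R)) B l
  rw [shiftLoop, shiftLoop, h, smul_pow, HahnSeries.single_pow]
  simp

end Shift

/-! ### Homogeneity of matrices and series -/

section Weights

theorem MatHasWeight.add {A B : Matrix (Fin n) (Fin n) (DiffPoly n)} {w : ℤ}
    (hA : MatHasWeight A w) (hB : MatHasWeight B w) : MatHasWeight (A + B) w :=
  fun i k => (hA i k).add (hB i k)

theorem MatHasWeight.sub {A B : Matrix (Fin n) (Fin n) (DiffPoly n)} {w : ℤ}
    (hA : MatHasWeight A w) (hB : MatHasWeight B w) : MatHasWeight (A - B) w :=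
  fun i k => (hA i k).sub (hB i k)

theorem matHasWeight_zero (w : ℤ) : MatHasWeight (0 : Matrix (Fin n) (Fin n) (DiffPoly n)) w :=
  fun _ _ => MvPolynomial.isWeightedHomogeneous_zero _ _ _

theorem isWeightedHomogeneous_sum {σ ι M : Type*} [AddCommMonoid M] {w : σ → M} {m : M}
    {S : Type*} [CommSemiring S] (s : Finset ι) (f : ι → MvPolynomial σ S)
    (h : ∀ i ∈ s, (f i).IsWeightedHomogeneous w m) : (∑ i ∈ s, f i).IsWeightedHomogeneous w m :=
  (MvPolynomial.weightedHomogeneousSubmodule S w m).sum_mem h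

theorem MatHasWeight.sum {ι : Type*} (s : Finset ι) {A : ι → Matrix (Fin n) (Fin n) (DiffPoly n)}
    {w : ℤ} (h : ∀ i ∈ s, MatHasWeight (A i) w) : MatHasWeight (∑ i ∈ s, A i) w := by
  intro i k
  rw [Matrix.sum_apply]
  exact isWeightedHomogeneous_sum _ _ fun j hj => h j hj i k

theorem MatHasWeight.mul {A B : Matrix (Fin n) (Fin n) (DiffPoly n)} {v w : ℤ}
    (hA : MatHasWeight A v) (hB : MatHasWeight B w) : MatHasWeight (A * B) (v + w) := by
  intro i k
  rw [Matrix.mul_apply]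
  refine isWeightedHomogeneous_sum _ _ fun j _ => ?_
  convert (hA i j).mul (hB j k) using 1
  ring

theorem matHasWeight_const {A : Matrix (Fin n) (Fin n) ℂ} {w : ℤ}
    (h : ∀ i k, A i k ≠ 0 → ((k : ℕ) : ℤ) - ((i : ℕ) : ℤ) = w) :
    MatHasWeight (A.map (MvPolynomial.C : ℂ → DiffPoly n)) w := by
  intro i k
  rw [Matrix.map_apply]
  by_cases hA : A i k = 0
  · rw [hA, map_zero]
    exact MvPolynomial.isWeightedHomogeneous_zero _ _ _
  · rw [h i k hA, sub_self]
    exact MvPolynomial.isWeightedHomogeneous_C _ _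

/-- The `m`-th coefficient has weight `m` for every `m`. -/
def PsGraded (B : Matrix (Fin n) (Fin n) (PowerSeries (DiffPoly n))) : Prop :=
  ∀ m : ℕ, MatHasWeight (psCoeff m B) m

theorem PsGraded.mul {A B : Matrix (Fin n) (Fin n) (PowerSeries (DiffPoly n))}
    (hA : PsGraded A) (hB : PsGraded B) : PsGraded (A * B) := by
  intro m
  rw [psCoeff_mul]
  refine MatHasWeight.sum _ fun p hp => ?_
  rw [← Finset.HasAntidiagonal.mem_antidiagonal.mp hp, Nat.cast_add]
  exact (hA p.1).mul (hB p.2)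

theorem PsGraded.one : PsGraded (1 : Matrix (Fin n) (Fin n) (PowerSeries (DiffPoly n))) := by
  intro m
  rw [psCoeff_one]
  split_ifs with hm
  · subst hm
    intro i k
    rw [Matrix.one_apply]
    split_ifs with h
    · subst h
      simpa using MvPolynomial.isWeightedHomogeneous_one ℂ (varWeight n)
    · exact MvPolynomial.isWeightedHomogeneous_zero _ _ _
  · exact matHasWeight_zero _

theorem PsGraded.pow {A : Matrix (Fin n) (Fin n) (PowerSeries (DiffPoly n))}
    (hA : PsGraded A) (k : ℕ) : PsGraded (A ^ k) := by
  induction k with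
  | zero => simpa using PsGraded.one
  | succ k ih => rw [pow_succ]; exact ih.mul hA

theorem PsGraded.loopHasWeight {B : Matrix (Fin n) (Fin n) (PowerSeries (DiffPoly n))}
    (hB : PsGraded B) (l : ℕ) : LoopHasWeight (shiftLoop l B) l := by
  intro s
  rw [coeffMat_shiftLoop, add_comm (l : ℤ)]
  split_ifs with h
  · have := hB (s + l).toNat
    rwa [Int.toNat_of_nonneg h] at this
  · exact matHasWeight_zero _

end Weights

/-! ### The universal recursion and its weights -/

section Recursion

/-- The derivation `∂_x` of differential polynomials. -/
def dTotal (n : ℕ) : Derivation ℂ (DiffPoly n) (DiffPoly n) :=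
  MvPolynomial.mkDerivation ℂ fun p => MvPolynomial.X (p.1, p.2 + 1)

/-- The matrix `b + u` of differential polynomials. -/
def symB (n : ℕ) : Matrix (Fin n) (Fin n) (DiffPoly n) :=
  (matB n).map MvPolynomial.C +
    ∑ k : Fin (n - 1), Matrix.map (matLambda n ^ ((k : ℕ) + 1))
      fun c => MvPolynomial.X (k, 0) * MvPolynomial.C c

/-- The coefficient of `λ^{-m}` of `λ⁻¹ P`, given an approximation `T` of `λ⁻¹ P` up to `λ^{1-m}`:
its off-diagonal part solves `[a, ·] = ∂_x T_{m-1} - [b + u, T_{m-1}]`, and its diagonal part is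
determined by `(λ⁻¹ P)^n = 1`. -/
def nextCoeff (m : ℕ) (T : Matrix (Fin n) (Fin n) (PowerSeries (DiffPoly n))) :
    Matrix (Fin n) (Fin n) (DiffPoly n) :=
  Matrix.of fun i k =>
    if i = k then
      MvPolynomial.C (-(n * (alpha n ^ (i : ℕ)) ^ (n - 1))⁻¹) * psCoeff (m + 1) (T ^ n) i i
    else
      MvPolynomial.C (alpha n ^ (i : ℕ) - alpha n ^ (k : ℕ))⁻¹ *
        ((psCoeff m T).map (dTotal n) - (symB n * psCoeff m T - psCoeff m T * symB n)) i k

/-- The truncation of `λ⁻¹ P` after `λ^{-m}`. -/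
def approx (n : ℕ) : ℕ → Matrix (Fin n) (Fin n) (PowerSeries (DiffPoly n))
  | 0 => psConst ((matA n).map MvPolynomial.C)
  | m + 1 => approx n m +
      (PowerSeries.X : PowerSeries (DiffPoly n)) ^ (m + 1) • psConst (nextCoeff m (approx n m))

/-- The series `λ⁻¹ P`. -/
def symW (n : ℕ) : Matrix (Fin n) (Fin n) (PowerSeries (DiffPoly n)) :=
  Matrix.of fun i k => PowerSeries.mk fun m => psCoeff m (approx n m) i k

theorem psCoeff_symW (m : ℕ) : psCoeff m (symW n) = psCoeff m (approx n m) := by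
  ext i k : 2
  simp [psCoeff, symW]

theorem psCoeff_approx_succ (m j : ℕ) : psCoeff j (approx n (m + 1)) =
    psCoeff j (approx n m) + if j = m + 1 then nextCoeff m (approx n m) else 0 := by
  rw [approx, psCoeff_add, psCoeff_X_pow_smul, psCoeff_psConst]
  congr 1
  split_ifs <;> first | rfl | omega

theorem psCoeff_approx_of_lt {m j : ℕ} (h : m < j) : psCoeff j (approx n m) = 0 := by
  induction m with
  | zero => rw [approx, psCoeff_psConst, if_neg (by omega)]
  | succ m ih => rw [psCoeff_approx_succ, ih (by omega), if_neg (by omega), add_zero]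

/-- Later steps only add terms of higher index, so the coefficients stabilise; this justifies
reading `symW` off the diagonal `approx n m` at index `m`. -/
theorem psCoeff_approx_of_le {m j : ℕ} (h : j ≤ m) :
    psCoeff j (approx n m) = psCoeff j (approx n j) := by
  induction m with
  | zero => rw [Nat.le_zero.mp h]
  | succ m ih =>
    rcases Nat.lt_or_eq_of_le h with h | rfl
    · rw [psCoeff_approx_succ, ih (by omega), if_neg (by omega), add_zero]
    · rfl

theorem psCoeff_approx_self_succ (m : ℕ) :
    psCoeff (m + 1) (approx n (m + 1)) = nextCoeff m (approx n m) := by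
  rw [psCoeff_approx_succ, psCoeff_approx_of_lt (Nat.lt_succ_self m), if_pos rfl, zero_add]

/-- By the Leibniz rule each term replaces one factor `∂ₓ^r u_k` by `∂ₓ^(r+1) u_k`, which costs one
unit of weight. -/
theorem isWeightedHomogeneous_dTotal {p : DiffPoly n} {w : ℤ}
    (hp : p.IsWeightedHomogeneous (varWeight n) w) :
    (dTotal n p).IsWeightedHomogeneous (varWeight n) (w + 1) := by
  classical
  rw [p.as_sum, map_sum]
  refine isWeightedHomogeneous_sum _ _ fun s hs => ?_
  have hw : Finsupp.weight (varWeight n) s = w := hp (MvPolynomial.mem_support_iff.mp hs)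
  rw [dTotal, MvPolynomial.mkDerivation_monomial, Finsupp.sum, Finset.smul_sum]
  refine isWeightedHomogeneous_sum _ _ fun q hq => ?_
  rw [MvPolynomial.smul_eq_C_mul]
  refine MvPolynomial.IsWeightedHomogeneous.C_mul ?_ _
  have h1 := (MvPolynomial.isWeightedHomogeneous_monomial (R := ℂ) (varWeight n)
    (s - Finsupp.single q 1) (s q : ℂ) rfl).mul
    (MvPolynomial.isWeightedHomogeneous_X ℂ (varWeight n) (q.1, q.2 + 1))
  rw [smul_eq_mul]
  convert h1 using 1
  -- The truncated subtraction is exact because `q` lies in the support of `s`.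
  have h2 : s - Finsupp.single q 1 + Finsupp.single q 1 = s :=
    tsub_add_cancel_of_le (by
      simpa [Finsupp.single_le_iff, Nat.one_le_iff_ne_zero] using hq)
  have h3 := congrArg (Finsupp.weight (varWeight n)) h2
  rw [map_add, Finsupp.weight_single, hw] at h3
  rw [← h3]
  simp only [varWeight, one_smul]
  push_cast
  ring

theorem matLambda_pow_apply_ne_zero (j : ℕ) (i k : Fin n)
    (h : (matLambda n ^ j) i k ≠ 0) : (i : ℕ) = k + j := by
  induction j generalizing i with
  | zero =>
    rw [pow_zero, Matrix.one_apply] at h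
    have : i = k := by by_contra h'; simp [h'] at h
    simp [this]
  | succ j ih =>
    rw [pow_succ', Matrix.mul_apply] at h
    obtain ⟨l, -, hl⟩ := Finset.exists_ne_zero_of_sum_ne_zero h
    have h1 := ih l (right_ne_zero_of_mul hl)
    have h2 : (i : ℕ) = l + 1 := by
      by_contra h'
      exact left_ne_zero_of_mul hl (by simp [matLambda, h'])
    omega

/-- The weight `j + 1` of `u_j` is chosen to offset the weight `-j` of `Λ^j`; `b` lies on the first
superdiagonal, of weight one. -/
theorem matHasWeight_symB (n : ℕ) : MatHasWeight (symB n) 1 := by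
  refine MatHasWeight.add (matHasWeight_const fun i k h => ?_) (MatHasWeight.sum _ fun j _ => ?_)
  · have : (k : ℕ) = i + 1 := by
      by_contra h'
      exact h (by simp [matB, h'])
    omega
  · intro i k
    rw [Matrix.map_apply]
    by_cases h : (matLambda n ^ ((j : ℕ) + 1)) i k = 0
    · rw [h, map_zero, mul_zero]
      exact MvPolynomial.isWeightedHomogeneous_zero _ _ _
    · have h1 := matLambda_pow_apply_ne_zero _ _ _ h
      convert (MvPolynomial.isWeightedHomogeneous_X ℂ (varWeight n) (j, 0)).mul
        (MvPolynomial.isWeightedHomogeneous_C (varWeight n)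
          ((matLambda n ^ ((j : ℕ) + 1)) i k)) using 1
      simp only [varWeight]
      push_cast [h1]
      ring

/-- Both `∂ₓ` and the commutator with `b + u` raise the weight by one, powers preserve the grading,
and the scalar factors have weight zero. -/
theorem matHasWeight_nextCoeff {m : ℕ} {T : Matrix (Fin n) (Fin n) (PowerSeries (DiffPoly n))}
    (hT : PsGraded T) : MatHasWeight (nextCoeff m T) ((m + 1 : ℕ) : ℤ) := by
  intro i k
  rw [nextCoeff, Matrix.of_apply]
  split_ifs with h
  · subst h
    exact (hT.pow n (m + 1) i i).C_mul _
  · refine MvPolynomial.IsWeightedHomogeneous.C_mul ?_ _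
    have h1 : MatHasWeight ((psCoeff m T).map (dTotal n)) ((m + 1 : ℕ) : ℤ) := by
      intro i k
      rw [Matrix.map_apply]
      convert isWeightedHomogeneous_dTotal (hT m i k) using 1
      push_cast
      ring
    have h2 := (matHasWeight_symB n).mul (hT m)
    have h3 := (hT m).mul (matHasWeight_symB n)
    rw [add_comm] at h2
    push_cast at h1 ⊢
    exact (h1.sub (h2.sub h3)) i k

theorem psGraded_approx (n m : ℕ) : PsGraded (approx n m) := by
  induction m with
  | zero =>
    intro m
    rw [approx, psCoeff_psConst]
    split_ifs with h
    · subst h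
      refine matHasWeight_const fun i k h => ?_
      have : i = k := by by_contra h'; simp [matA, h'] at h
      simp [this]
    · exact matHasWeight_zero _
  | succ m ih =>
    intro j
    rw [psCoeff_approx_succ]
    refine (ih j).add ?_
    split_ifs with h
    · subst h
      exact matHasWeight_nextCoeff ih
    · exact matHasWeight_zero _

theorem psGraded_symW (n : ℕ) : PsGraded (symW n) := by
  intro m
  rw [psCoeff_symW]
  exact psGraded_approx n m m

end Recursion

/-! ### Evaluation on functions and uniqueness of the solution -/

section Evaluation

variable {U : Set ℝ} {u : Fin (n - 1) → ℝ → ℂ}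

/-- Evaluation intertwines the formal derivation with `d/dx`; openness of `U` lets `iteratedDeriv`
be replaced by the derivative within `U`. -/
theorem hasDerivAt_evalAt (hU : IsOpen U) (hu : ∀ k, ContDiffOn ℝ (↑(⊤ : ℕ∞)) (u k) U)
    {x : ℝ} (hx : x ∈ U) (p : DiffPoly n) :
    HasDerivAt (fun y => evalAt u y p) (evalAt u x (dTotal n p)) x := by
  induction p using MvPolynomial.induction_on with
  | C c =>
    have h : dTotal n (MvPolynomial.C c) = 0 := (dTotal n).map_algebraMap c
    simpa [h, evalAt] using hasDerivAt_const x c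
  | add p q hp hq => simpa using hp.fun_add hq
  | mul_X p q hp =>
    have h : HasDerivAt (iteratedDeriv q.2 (u q.1)) (iteratedDeriv (q.2 + 1) (u q.1) x) x := by
      have h1 : DifferentiableOn ℝ (iteratedDerivWithin q.2 (u q.1) U) U :=
        (hu q.1).differentiableOn_iteratedDerivWithin (by exact_mod_cast ENat.natCast_lt_top q.2)
          hU.uniqueDiffOn
      have h2 : DifferentiableAt ℝ (iteratedDeriv q.2 (u q.1)) x :=
        ((h1.congr fun y hy => (iteratedDerivWithin_of_isOpen hU hy).symm) x hx).differentiableAt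
          (hU.mem_nhds hx)
      rw [iteratedDeriv_succ]
      exact h2.hasDerivAt
    have h' : dTotal n (MvPolynomial.X q) = MvPolynomial.X (q.1, q.2 + 1) :=
      MvPolynomial.mkDerivation_X _ _ _
    have := hp.fun_mul h
    have hX : ∀ y (r : Fin (n - 1) × ℕ),
        evalAt u y (MvPolynomial.X r) = iteratedDeriv r.2 (u r.1) y := fun y r =>
      MvPolynomial.aeval_X _ _
    rw [Derivation.leibniz, h', smul_eq_mul, smul_eq_mul, map_add, map_mul, map_mul, hX, hX]
    simp only [map_mul, hX]
    rw [add_comm, mul_comm (iteratedDeriv _ _ _)]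
    exact this

theorem map_symB_evalAt (x : ℝ) : (symB n).map (evalAt u x) = matB n + uMat u x := by
  ext i k
  simp [symB, uMat, evalAt, Matrix.sum_apply]

/-- A series `W` with leading coefficient `a` that satisfies `W^n = 1` and the Lax equation
`∂_x W = [a λ + b + u, W]` is the evaluation of the universal series. -/
theorem psCoeff_eq_eval_symW (hn : 2 ≤ n) (hU : IsOpen U)
    (hu : ∀ k, ContDiffOn ℝ (↑(⊤ : ℕ∞)) (u k) U)
    {W : ℝ → Matrix (Fin n) (Fin n) (PowerSeries ℂ)}
    (h0 : ∀ x ∈ U, psCoeff 0 (W x) = matA n) (hpow : ∀ x ∈ U, W x ^ n = 1)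
    (hlax : ∀ x ∈ U, ∀ m i k, HasDerivAt (fun y => psCoeff m (W y) i k)
      ((matA n * psCoeff (m + 1) (W x) - psCoeff (m + 1) (W x) * matA n
        + ((matB n + uMat u x) * psCoeff m (W x)
          - psCoeff m (W x) * (matB n + uMat u x))) i k) x)
    (m : ℕ) : ∀ x ∈ U, psCoeff m (W x) = (psCoeff m (symW n)).map (evalAt u x) := by
  have hprim : IsPrimitiveRoot (alpha n) n := Complex.isPrimitiveRoot_exp n (by omega)
  have hα : alpha n ≠ 0 := hprim.ne_zero (by omega)
  have hn0 : (n : ℂ) ≠ 0 := by exact_mod_cast (by omega : n ≠ 0)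
  induction m using Nat.strong_induction_on with
  | _ m ih =>
  intro x hx
  rw [psCoeff_symW]
  rcases m with _ | m
  · rw [h0 x hx, approx, psCoeff_psConst, if_pos rfl]
    ext i k
    simp [evalAt]
  rw [psCoeff_approx_self_succ]
  have ih' : ∀ j ≤ m, ∀ y ∈ U,
      psCoeff j (W y) = (psCoeff j (approx n m)).map (evalAt u y) := by
    intro j hj y hy
    rw [ih j (by omega) y hy, psCoeff_symW, psCoeff_approx_of_le hj]
  ext i k
  rw [Matrix.map_apply, nextCoeff, Matrix.of_apply]
  split_ifs with hik
  · subst hik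
    -- `T` is the evaluated truncation: it agrees with `W x` through index `m` and vanishes at index
    -- `m + 1`.
    set T := (approx n m).map (PowerSeries.map (evalAt u x : DiffPoly n →+* ℂ)) with hTdef
    have hT : ∀ j, psCoeff j T = (psCoeff j (approx n m)).map (evalAt u x) := fun j => by
      rw [hTdef, psCoeff_map]; rfl
    have hTpow : psCoeff (m + 1) (T ^ n)
        = (psCoeff (m + 1) (approx n m ^ n)).map (evalAt u x) := by
      have : T ^ n = (approx n m ^ n).map (PowerSeries.map (evalAt u x : DiffPoly n →+* ℂ)) :=
        (map_pow (RingHom.mapMatrix (PowerSeries.map (evalAt u x : DiffPoly n →+* ℂ)))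
          (approx n m) n).symm
      rw [this, psCoeff_map]; rfl
    have hT0 : psCoeff 0 T = Matrix.diagonal fun i : Fin n => alpha n ^ (i : ℕ) := by
      rw [hT, ← ih' 0 (Nat.zero_le _) x hx, h0 x hx, matA]
    have hvan : ∀ j < m + 1, psCoeff j (W x - T) = 0 := fun j hj => by
      rw [psCoeff_sub, hT, ih' j (by omega) x hx, sub_self]
    -- Since `W x ^ n = 1` has no coefficient of index `m + 1`, this is a linear equation for the
    -- diagonal entry of `W_{m+1}`.
    have key := (psCoeff_pow_sub_pow (h0 x hx) hT0 hvan n).2 i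
    have hT1 : psCoeff (m + 1) T = 0 := by
      rw [hT, psCoeff_approx_of_lt (Nat.lt_succ_self m)]
      ext; simp
    rw [psCoeff_sub, psCoeff_sub, hpow x hx, psCoeff_one, if_neg (Nat.succ_ne_zero m), hT1,
      hTpow, sub_zero, zero_sub, Matrix.neg_apply, Matrix.map_apply] at key
    have hc : (n : ℂ) * (alpha n ^ (i : ℕ)) ^ (n - 1) ≠ 0 :=
      mul_ne_zero hn0 (pow_ne_zero _ (pow_ne_zero _ hα))
    have : evalAt u x (MvPolynomial.C (-(n * (alpha n ^ (i : ℕ)) ^ (n - 1))⁻¹))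
        = -(n * (alpha n ^ (i : ℕ)) ^ (n - 1))⁻¹ := by simp [evalAt]
    rw [map_mul, this, neg_mul, ← mul_neg, key, inv_mul_cancel_left₀ hc]
  · have hd : alpha n ^ (i : ℕ) - alpha n ^ (k : ℕ) ≠ 0 := by
      intro h
      exact hik (Fin.ext (hprim.pow_inj i.2 k.2 (sub_eq_zero.mp h)))
    -- The induction hypothesis holds on all of the open set `U`, so it may be differentiated;
    -- comparison with the Lax equation isolates `[a, W_{m+1}]`.
    have h1 : HasDerivAt (fun y => psCoeff m (W y) i k)
        (evalAt u x (dTotal n (psCoeff m (approx n m) i k))) x := by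
      refine (hasDerivAt_evalAt hU hu hx _).congr_of_eventuallyEq ?_
      filter_upwards [hU.mem_nhds hx] with y hy
      rw [ih' m le_rfl y hy, Matrix.map_apply]
    have h2 := (hlax x hx m i k).unique h1
    have h3 : evalAt u x ((symB n * psCoeff m (approx n m)
          - psCoeff m (approx n m) * symB n) i k)
        = ((matB n + uMat u x) * psCoeff m (W x)
          - psCoeff m (W x) * (matB n + uMat u x)) i k := by
      rw [ih' m le_rfl x hx, ← map_symB_evalAt]
      simp [Matrix.mul_apply]
    have : evalAt u x (MvPolynomial.C (alpha n ^ (i : ℕ) - alpha n ^ (k : ℕ))⁻¹)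
        = (alpha n ^ (i : ℕ) - alpha n ^ (k : ℕ))⁻¹ := by simp [evalAt]
    rw [map_mul, this, Matrix.sub_apply, map_sub, h3, Matrix.map_apply, ← h2, Matrix.add_apply,
      add_sub_cancel_right, Matrix.sub_apply, matA, Matrix.diagonal_mul, Matrix.mul_diagonal,
      mul_comm (psCoeff (m + 1) (W x) i k), ← sub_mul, inv_mul_cancel_left₀ hd]

end Evaluation

/-! ### Coefficientwise differentiation in `x` -/

section Derivative

/-- Coefficientwise derivative of a matrix of power series depending on a real parameter. -/
def HasPsDerivAt (F : ℝ → Matrix (Fin n) (Fin n) (PowerSeries ℂ))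
    (F' : Matrix (Fin n) (Fin n) (PowerSeries ℂ)) (x : ℝ) : Prop :=
  ∀ m i k, HasDerivAt (fun y => psCoeff m (F y) i k) (psCoeff m F' i k) x

theorem hasPsDerivAt_const (A : Matrix (Fin n) (Fin n) (PowerSeries ℂ)) (x : ℝ) :
    HasPsDerivAt (fun _ => A) 0 x := by
  intro m i k
  rw [psCoeff_zero]
  exact hasDerivAt_const _ _

theorem HasPsDerivAt.mul {F G : ℝ → Matrix (Fin n) (Fin n) (PowerSeries ℂ)}
    {F' G' : Matrix (Fin n) (Fin n) (PowerSeries ℂ)} {x : ℝ}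
    (hF : HasPsDerivAt F F' x) (hG : HasPsDerivAt G G' x) :
    HasPsDerivAt (fun y => F y * G y) (F' * G x + F x * G') x := by
  intro m i k
  rw [psCoeff_add, psCoeff_mul, psCoeff_mul, ← Finset.sum_add_distrib]
  simp only [psCoeff_mul, Matrix.sum_apply, Matrix.add_apply, Matrix.mul_apply,
    ← Finset.sum_add_distrib]
  exact HasDerivAt.fun_sum fun p _ => HasDerivAt.fun_sum fun j _ =>
    (hF p.1 i j).fun_mul (hG p.2 j k)

theorem HasPsDerivAt.unique {F G : ℝ → Matrix (Fin n) (Fin n) (PowerSeries ℂ)}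
    {F' G' : Matrix (Fin n) (Fin n) (PowerSeries ℂ)} {x : ℝ}
    (hF : HasPsDerivAt F F' x) (hG : HasPsDerivAt G G' x) (h : ∀ᶠ y in nhds x, F y = G y) :
    F' = G' := by
  refine psCoeff_ext fun m => ?_
  ext i k
  refine (hF m i k).unique ((hG m i k).congr_of_eventuallyEq ?_)
  filter_upwards [h] with y hy
  rw [hy]

theorem psCoeff_mul_eq_sum_add {R : Type} [CommRing R] (m : ℕ)
    (A B : Matrix (Fin n) (Fin n) (PowerSeries R)) :
    psCoeff m (A * B)
      = ∑ j ∈ Finset.range m, psCoeff j A * psCoeff (m - j) B + psCoeff m A * psCoeff 0 B := by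
  rw [psCoeff_mul, Finset.Nat.sum_antidiagonal_eq_sum_range_succ
    (fun i j => psCoeff i A * psCoeff j B), Finset.sum_range_succ, Nat.sub_self]

/-- Left quotients of differentiable series by differentiable series `I + O(λ⁻¹)` are
differentiable. -/
theorem differentiableAt_of_mul_eq {F G H : ℝ → Matrix (Fin n) (Fin n) (PowerSeries ℂ)}
    {G' H' : Matrix (Fin n) (Fin n) (PowerSeries ℂ)} {x : ℝ}
    (hG : HasPsDerivAt G G' x) (hH : HasPsDerivAt H H' x)
    (h : ∀ᶠ y in nhds x, F y * G y = H y ∧ psCoeff 0 (G y) = 1) :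
    ∃ F', HasPsDerivAt F F' x := by
  -- As `G` has leading coefficient one, `F_m = H_m - ∑_{j<m} F_j G_{m-j}`.
  have key : ∀ m i k, DifferentiableAt ℝ (fun y => psCoeff m (F y) i k) x := by
    intro m
    induction m using Nat.strong_induction_on with
    | _ m ih =>
    intro i k
    have hd : DifferentiableAt ℝ (fun y => psCoeff m (H y) i k
        - ∑ j ∈ Finset.range m, ∑ l, psCoeff j (F y) i l * psCoeff (m - j) (G y) l k) x :=
      (hH m i k).differentiableAt.fun_sub <| DifferentiableAt.fun_sum fun j hj =>
        DifferentiableAt.fun_sum fun l _ =>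
          (ih j (Finset.mem_range.mp hj) i l).fun_mul (hG (m - j) l k).differentiableAt
    refine hd.congr_of_eventuallyEq ?_
    filter_upwards [h] with y hy
    rw [← hy.1, psCoeff_mul_eq_sum_add, hy.2, mul_one, Matrix.add_apply, Matrix.sum_apply]
    simp [Matrix.mul_apply]
  refine ⟨Matrix.of fun i k => PowerSeries.mk fun m =>
    deriv (fun y => psCoeff m (F y) i k) x, fun m i k => ?_⟩
  simpa [psCoeff] using (key m i k).hasDerivAt

end Derivative

/-! ### Bare wave functions: the power relation, the gauge equation and the Lax equation -/

section BareWave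

/-- The series `λ⁻¹ J = a + b λ⁻¹`. -/
def psJ (n : ℕ) : Matrix (Fin n) (Fin n) (PowerSeries ℂ) :=
  psConst (matA n) + (PowerSeries.X : PowerSeries ℂ) • psConst (matB n)

theorem psCoeff_psJ_zero : psCoeff 0 (psJ n) = matA n := by
  rw [psJ, psCoeff_add, psCoeff_X_smul_zero, psCoeff_psConst, if_pos rfl, add_zero]

theorem psCoeff_psJ_of_two_le {m : ℕ} (hm : 2 ≤ m) : psCoeff m (psJ n) = 0 := by
  obtain ⟨m, rfl⟩ := Nat.exists_eq_add_of_le' (Nat.one_le_of_lt hm)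
  rw [psJ, psCoeff_add, psCoeff_X_smul_succ, psCoeff_psConst, psCoeff_psConst,
    if_neg (by omega), if_neg (by omega), add_zero]

theorem psCoeff_succ_mul (v : Matrix (Fin n) (Fin n) ℂ) (m : ℕ)
    (W : Matrix (Fin n) (Fin n) (PowerSeries ℂ)) :
    psCoeff (m + 1) ((psJ n + (PowerSeries.X : PowerSeries ℂ) • psConst v) * W)
      = matA n * psCoeff (m + 1) W + (matB n + v) * psCoeff m W := by
  rw [psJ, add_mul, add_mul, smul_mul_assoc, smul_mul_assoc, psCoeff_add, psCoeff_add,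
    psCoeff_X_smul_succ, psCoeff_X_smul_succ, psCoeff_psConst_mul, psCoeff_psConst_mul,
    psCoeff_psConst_mul, add_mul, add_assoc]

theorem psCoeff_mul_succ (v : Matrix (Fin n) (Fin n) ℂ) (m : ℕ)
    (W : Matrix (Fin n) (Fin n) (PowerSeries ℂ)) :
    psCoeff (m + 1) (W * (psJ n + (PowerSeries.X : PowerSeries ℂ) • psConst v))
      = psCoeff (m + 1) W * matA n + psCoeff m W * (matB n + v) := by
  rw [psJ, mul_add, mul_add, mul_smul_comm, mul_smul_comm, psCoeff_add, psCoeff_add,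
    psCoeff_X_smul_succ, psCoeff_X_smul_succ, psCoeff_mul_psConst, psCoeff_mul_psConst,
    psCoeff_mul_psConst, mul_add, add_assoc]

/-- The characteristic polynomial is `∏ (X - α^i) = X^n - 1`, and Cayley–Hamilton applies. -/
theorem psJ_pow (hn : 2 ≤ n) : psJ n ^ n = 1 := by
  have hprim : IsPrimitiveRoot (alpha n) n := Complex.isPrimitiveRoot_exp n (by omega)
  have hupper : (psJ n).IsUpperTriangular := by
    intro i k hki
    have h1 : i ≠ k := fun h => by simp [h] at hki
    have h2 : (k : ℕ) ≠ i + 1 := fun h => by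
      have : (k : ℕ) < i := hki
      omega
    simp [psJ, psConst, matA, matB, h1, h2]
  have hdiag : ∀ i, psJ n i i = PowerSeries.C (alpha n ^ (i : ℕ)) := by
    intro i
    simp [psJ, psConst, matA, matB]
  have hchar : (psJ n).charpoly = Polynomial.X ^ n - 1 := by
    rw [Matrix.charpoly_of_isUpperTriangular _ hupper]
    have h := congrArg (Polynomial.map (PowerSeries.C (R := ℂ)))
      (X_pow_sub_C_eq_prod hprim (α := 1) (a := 1) (by omega) (one_pow n))
    simp only [Polynomial.map_sub, Polynomial.map_pow, Polynomial.map_X, Polynomial.map_C,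
      Polynomial.map_one, map_one, mul_one, Polynomial.map_prod] at h
    rw [h, Finset.prod_range]
    simp only [hdiag]
  have h := Matrix.aeval_self_charpoly (psJ n)
  rw [hchar] at h
  simpa [sub_eq_zero] using h

theorem toLoop_mul (A B : Matrix (Fin n) (Fin n) (PowerSeries ℂ)) :
    toLoop (A * B) = toLoop A * toLoop B :=
  map_mul (RingHom.mapMatrix (HahnSeries.ofPowerSeries ℤ ℂ)) A B

theorem toLoop_add (A B : Matrix (Fin n) (Fin n) (PowerSeries ℂ)) :
    toLoop (A + B) = toLoop A + toLoop B :=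
  map_add (RingHom.mapMatrix (HahnSeries.ofPowerSeries ℤ ℂ)) A B

theorem toLoop_injective :
    Function.Injective (toLoop : Matrix (Fin n) (Fin n) (PowerSeries ℂ) → Loop n ℂ) :=
  Matrix.map_injective HahnSeries.ofPowerSeries_injective

theorem toLoop_X_smul (A : Matrix (Fin n) (Fin n) (PowerSeries ℂ)) :
    toLoop ((PowerSeries.X : PowerSeries ℂ) • A)
      = (HahnSeries.single 1 1 : LaurentSeries ℂ) • toLoop A := by
  ext i k : 2
  simp [toLoop, HahnSeries.ofPowerSeries_X]

theorem toLoop_psConst (A : Matrix (Fin n) (Fin n) ℂ) : toLoop (psConst A) = constLoop A := by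
  ext i k : 2
  simp [toLoop, psConst, constLoop, HahnSeries.ofPowerSeries_C]

theorem toLoop_inv {A : Matrix (Fin n) (Fin n) (PowerSeries ℂ)} (hA : A.det = 1) :
    (toLoop A)⁻¹ = toLoop A⁻¹ := by
  refine Matrix.inv_eq_right_inv ?_
  rw [← toLoop_mul, Matrix.mul_nonsing_inv _ (by rw [hA]; exact isUnit_one)]
  exact map_one (RingHom.mapMatrix (HahnSeries.ofPowerSeries ℤ ℂ))

theorem shiftLoop_one (B : Matrix (Fin n) (Fin n) (PowerSeries ℂ)) :
    shiftLoop 1 B = lam • toLoop B := rfl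

theorem loop_smul_add (c : LaurentSeries ℂ) (A B : Loop n ℂ) : c • (A + B) = c • A + c • B :=
  smul_add c A B

theorem loop_smul_mul (c : LaurentSeries ℂ) (A B : Loop n ℂ) : (c • A) * B = c • (A * B) :=
  Matrix.smul_mul c A B

theorem loop_mul_smul (c : LaurentSeries ℂ) (A B : Loop n ℂ) : A * (c • B) = c • (A * B) :=
  Matrix.mul_smul A c B

theorem single_smul_lam_smul (A : Loop n ℂ) :
    (HahnSeries.single 1 1 : LaurentSeries ℂ) • lam • A = A := by
  rw [smul_smul, lam, HahnSeries.single_mul_single, add_neg_cancel, mul_one]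
  exact one_smul _ A

theorem lam_smul_single_smul (A : Loop n ℂ) :
    lam • (HahnSeries.single 1 1 : LaurentSeries ℂ) • A = A := by
  rw [smul_smul, lam, HahnSeries.single_mul_single, neg_add_cancel, mul_one]
  exact one_smul _ A

theorem J_eq_lam_smul : J n = lam • toLoop (psJ n) := by
  rw [psJ, toLoop_add, toLoop_X_smul, toLoop_psConst, toLoop_psConst, loop_smul_add,
    lam_smul_single_smul, J]

variable {U : Set ℝ} {u : Fin (n - 1) → ℝ → ℂ}
  {M : ℝ → Matrix (Fin n) (Fin n) (PowerSeries ℂ)}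

/-- The series `λ⁻¹ Q = M (λ⁻¹ J) M⁻¹`. -/
def psQ (M : ℝ → Matrix (Fin n) (Fin n) (PowerSeries ℂ)) (x : ℝ) :
    Matrix (Fin n) (Fin n) (PowerSeries ℂ) :=
  M x * psJ n * (M x)⁻¹

theorem Q_eq_shiftLoop {x : ℝ} (h : (M x).det = 1) : Q M x = shiftLoop 1 (psQ M x) := by
  rw [Q, toLoop_inv h, J_eq_lam_smul, shiftLoop_one, psQ, toLoop_mul, toLoop_mul,
    loop_mul_smul, loop_smul_mul]

theorem IsBareWave.det_eq_one (h : IsBareWave U u M) {x : ℝ} (hx : x ∈ U) : (M x).det = 1 :=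
  (h.mem x hx).det_eq_one

theorem IsBareWave.isUnit_det (h : IsBareWave U u M) {x : ℝ} (hx : x ∈ U) :
    IsUnit (M x).det := by
  rw [h.det_eq_one hx]; exact isUnit_one

theorem IsBareWave.psCoeff_zero_eq_one (h : IsBareWave U u M) {x : ℝ} (hx : x ∈ U) :
    psCoeff 0 (M x) = 1 := by
  rw [← (h.mem x hx).at_infinity]
  ext i k
  simp [psCoeff]

theorem IsBareWave.psQ_mul (h : IsBareWave U u M) {x : ℝ} (hx : x ∈ U) :
    psQ M x * M x = M x * psJ n := by
  rw [psQ, Matrix.mul_assoc, Matrix.nonsing_inv_mul _ (h.isUnit_det hx), mul_one]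

theorem IsBareWave.psCoeff_psQ_zero (h : IsBareWave U u M) {x : ℝ} (hx : x ∈ U) :
    psCoeff 0 (psQ M x) = matA n := by
  have := congrArg (psCoeff 0) (h.psQ_mul hx)
  rw [psCoeff_mul, psCoeff_mul] at this
  simpa [h.psCoeff_zero_eq_one hx, psCoeff_psJ_zero] using this

theorem IsBareWave.psQ_pow (hn : 2 ≤ n) (h : IsBareWave U u M) {x : ℝ} (hx : x ∈ U) :
    psQ M x ^ n = 1 := by
  have key : ∀ k, psQ M x ^ k * M x = M x * psJ n ^ k := by
    intro k
    induction k with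
    | zero => simp
    | succ k ih => rw [pow_succ, Matrix.mul_assoc, h.psQ_mul hx, ← Matrix.mul_assoc, ih,
        Matrix.mul_assoc, pow_succ]
  have h1 := congrArg (· * (M x)⁻¹) (key n)
  simpa [psJ_pow hn, Matrix.mul_assoc, Matrix.mul_nonsing_inv _ (h.isUnit_det hx)] using h1

theorem IsBareWave.hasPsDerivAt (hU : IsOpen U) (h : IsBareWave U u M) {x : ℝ} (hx : x ∈ U) :
    HasPsDerivAt M (dx M x) x := by
  intro m i k
  have hd := ((h.smooth i k m).contDiffAt (hU.mem_nhds hx)).differentiableAt (by simp)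
  simpa [psCoeff, dx] using hd.hasDerivAt

/-- Multiplying the gauge equation by `λ⁻¹` removes the positive powers of `λ`, so it can be read
among power series. -/
theorem IsBareWave.gauge_ps (h : IsBareWave U u M) {x : ℝ} (hx : x ∈ U) :
    (PowerSeries.X : PowerSeries ℂ) • (dx M x * (M x)⁻¹) + psQ M x
      = psJ n + (PowerSeries.X : PowerSeries ℂ) • psConst (uMat u x) := by
  have hg := h.gauge x hx
  have hQ : toLoop (M x) * J n * (toLoop (M x))⁻¹ = lam • toLoop (psQ M x) :=
    Q_eq_shiftLoop (h.det_eq_one hx)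
  rw [hQ, J_eq_lam_smul, toLoop_inv (h.det_eq_one hx)] at hg
  replace hg := congrArg (fun A => (HahnSeries.single 1 1 : LaurentSeries ℂ) • A) hg
  simp only [loop_smul_add, single_smul_lam_smul] at hg
  apply toLoop_injective
  rw [toLoop_add, toLoop_add, toLoop_X_smul, toLoop_X_smul, toLoop_psConst, toLoop_mul, hg]

/-- The Lax equation `∂_x Q = [J + u, Q]`, coefficient by coefficient. -/
theorem IsBareWave.hasDerivAt_psQ (hU : IsOpen U) (h : IsBareWave U u M) {x : ℝ} (hx : x ∈ U)
    (m : ℕ) (i k : Fin n) :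
    HasDerivAt (fun y => psCoeff m (psQ M y) i k)
      ((matA n * psCoeff (m + 1) (psQ M x) - psCoeff (m + 1) (psQ M x) * matA n
        + ((matB n + uMat u x) * psCoeff m (psQ M x)
          - psCoeff m (psQ M x) * (matB n + uMat u x))) i k) x := by
  have hM := h.hasPsDerivAt hU hx
  have hMJ := hM.mul (hasPsDerivAt_const (psJ n) x)
  have hev : ∀ᶠ y in nhds x, psQ M y * M y = M y * psJ n ∧ psCoeff 0 (M y) = 1 := by
    filter_upwards [hU.mem_nhds hx] with y hy
    exact ⟨h.psQ_mul hy, h.psCoeff_zero_eq_one hy⟩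
  -- The coefficients of `psQ M` are not known to be differentiable beforehand; `W M = M (λ⁻¹ J)`
  -- exhibits `W` as a quotient.
  obtain ⟨W', hW'⟩ := differentiableAt_of_mul_eq hM hMJ hev
  have e1 := (hW'.mul hM).unique hMJ (hev.mono fun y hy => hy.1)
  rw [mul_zero, add_zero] at e1
  have hinv := Matrix.mul_nonsing_inv _ (h.isUnit_det hx)
  have hinv' := Matrix.nonsing_inv_mul _ (h.isUnit_det hx)
  set B := dx M x * (M x)⁻¹ with hB
  have hBM : B * M x = dx M x := by rw [hB, Matrix.mul_assoc, hinv', mul_one]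
  -- Differentiating `W M = M (λ⁻¹ J)` gives `∂ₓ W = [B, W]` with `B = (∂ₓ M) M⁻¹`.
  have e2 : W' = B * psQ M x - psQ M x * B := by
    have e3 : W' * M x = (B * psQ M x - psQ M x * B) * M x := by
      rw [sub_mul, Matrix.mul_assoc B, Matrix.mul_assoc _ B, h.psQ_mul hx, hBM,
        ← Matrix.mul_assoc B, hBM, ← e1, add_sub_cancel_right]
    have e4 := congrArg (· * (M x)⁻¹) e3
    simpa only [Matrix.mul_assoc, hinv, mul_one] using e4
  -- By the gauge equation `λ⁻¹ B` equals `λ⁻¹ (J + u) - W`, and `W` drops out of the commutator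
  -- with itself.
  have e5 : (PowerSeries.X : PowerSeries ℂ) • W'
      = (psJ n + (PowerSeries.X : PowerSeries ℂ) • psConst (uMat u x)) * psQ M x
        - psQ M x * (psJ n + (PowerSeries.X : PowerSeries ℂ) • psConst (uMat u x)) := by
    rw [← h.gauge_ps hx, e2, smul_sub, add_mul, mul_add, smul_mul_assoc, mul_smul_comm]
    abel
  have e6 := congrArg (psCoeff (m + 1)) e5
  rw [psCoeff_X_smul_succ, psCoeff_sub, psCoeff_succ_mul, psCoeff_mul_succ] at e6
  convert hW' m i k using 1
  rw [e6, sub_add_sub_comm]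

theorem IsBareWave.psQ_eq_map_symW (hn : 2 ≤ n) (hU : IsOpen U)
    (hu : ∀ k, ContDiffOn ℝ (↑(⊤ : ℕ∞)) (u k) U) (h : IsBareWave U u M) {x : ℝ} (hx : x ∈ U) :
    psQ M x = (symW n).map (PowerSeries.map (evalAt u x : DiffPoly n →+* ℂ)) := by
  refine psCoeff_ext fun m => ?_
  rw [psCoeff_map]
  exact psCoeff_eq_eval_symW hn hU hu (fun y hy => h.psCoeff_psQ_zero hy)
    (fun y hy => h.psQ_pow hn hy) (fun y hy => h.hasDerivAt_psQ hU hy) m x hx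

theorem constantCoeff_symW (hn : 2 ≤ n) (m : ℕ) (hm : 2 ≤ m) (i k : Fin n) :
    MvPolynomial.constantCoeff (psCoeff m (symW n) i k) = 0 := by
  have hu0 : ∀ x, uMat (fun (_ : Fin (n - 1)) (_ : ℝ) => (0 : ℂ)) x = 0 := fun x => by
    simp [uMat]
  -- The constant series `psJ n` solves the Lax equation for `u = 0`, since it commutes with itself.
  have key := psCoeff_eq_eval_symW (n := n) (U := Set.univ) (u := fun _ _ => 0)
    (W := fun _ => psJ n) hn isOpen_univ (fun _ => contDiffOn_const)
    (fun _ _ => psCoeff_psJ_zero) (fun _ _ => psJ_pow hn) (fun x _ m i k => by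
      have e := (psCoeff_succ_mul 0 m (psJ n)).symm
      have e' := (psCoeff_mul_succ 0 m (psJ n)).symm
      have hz : psConst (0 : Matrix (Fin n) (Fin n) ℂ) = 0 := by ext; simp [psConst]
      rw [hz, smul_zero, add_zero (psJ n)] at e e'
      rw [hu0]
      have : matA n * psCoeff (m + 1) (psJ n) - psCoeff (m + 1) (psJ n) * matA n
          + ((matB n + 0) * psCoeff m (psJ n) - psCoeff m (psJ n) * (matB n + 0)) = 0 := by
        rw [sub_add_sub_comm, e, e', sub_self]
      rw [this]
      exact hasDerivAt_const _ _) m 0 (Set.mem_univ _)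
  rw [psCoeff_psJ_of_two_le hm] at key
  have h := (congrFun (congrFun key i) k).symm
  -- All derivatives of the zero function vanish, so evaluation there extracts the constant term.
  have hev : (evalAt (fun (_ : Fin (n - 1)) (_ : ℝ) => (0 : ℂ)) 0 : DiffPoly n →ₐ[ℂ] ℂ)
      = MvPolynomial.aeval fun _ => 0 := by
    rw [evalAt]
    congr 1
    ext p
    simp
  rw [Matrix.map_apply, hev] at h
  simpa [MvPolynomial.constantCoeff_eq, MvPolynomial.aeval_zero'] using h

end BareWave

end NKdV

end

theorem mainTheorem10 (n : ℕ) (hn : 2 ≤ n) :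
    ∃ P : NKdV.Loop n (NKdV.DiffPoly n),
      (∀ j : ℤ, NKdV.MatHasWeight (NKdV.coeffMat P j) (j + 1)) ∧
      (∀ j : ℤ, 1 ≤ j → ∀ i k, MvPolynomial.constantCoeff (NKdV.coeffMat P j i k) = 0) ∧
      (∀ l : ℕ, NKdV.LoopHasWeight (P ^ l) (l : ℤ)) ∧
      ∀ (U : Set ℝ) (u : Fin (n - 1) → ℝ → ℂ)
        (M : ℝ → Matrix (Fin n) (Fin n) (PowerSeries ℂ)),
        IsOpen U → (∀ k, ContDiffOn ℝ (↑(⊤ : ℕ∞)) (u k) U) → NKdV.IsBareWave U u M →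
        ∀ x ∈ U,
          (∀ j : ℤ, NKdV.coeffMat (NKdV.Q M x) j =
            (NKdV.coeffMat P j).map (NKdV.evalAt u x)) ∧
          (∀ (l : ℕ) (s : ℤ), NKdV.coeffMat (NKdV.Q M x ^ l) s =
            (NKdV.coeffMat (P ^ l) s).map (NKdV.evalAt u x)) := by
  have hpow : ∀ (U : Set ℝ) (u : Fin (n - 1) → ℝ → ℂ)
      (M : ℝ → Matrix (Fin n) (Fin n) (PowerSeries ℂ)), IsOpen U →
      (∀ k, ContDiffOn ℝ (↑(⊤ : ℕ∞)) (u k) U) → NKdV.IsBareWave U u M → ∀ x ∈ U,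
      ∀ (l : ℕ) (s : ℤ), NKdV.coeffMat (NKdV.Q M x ^ l) s =
        (NKdV.coeffMat (NKdV.shiftLoop 1 (NKdV.symW n) ^ l) s).map (NKdV.evalAt u x) := by
    intro U u M hU hu h x hx l s
    have hmap : NKdV.psQ M x ^ l = (NKdV.symW n ^ l).map
        (PowerSeries.map (NKdV.evalAt u x : NKdV.DiffPoly n →+* ℂ)) := by
      rw [h.psQ_eq_map_symW hn hU hu hx]
      exact (map_pow (RingHom.mapMatrix
        (PowerSeries.map (NKdV.evalAt u x : NKdV.DiffPoly n →+* ℂ))) _ _).symm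
    rw [NKdV.Q_eq_shiftLoop (h.det_eq_one hx), NKdV.shiftLoop_pow, NKdV.shiftLoop_pow,
      NKdV.coeffMat_shiftLoop, NKdV.coeffMat_shiftLoop, hmap, NKdV.psCoeff_map]
    split_ifs
    · rfl
    · ext; simp
  refine ⟨NKdV.shiftLoop 1 (NKdV.symW n), fun j => ?_, fun j hj i k => ?_, fun l => ?_,
    fun U u M hU hu h x hx => ⟨fun j => ?_, hpow U u M hU hu h x hx⟩⟩
  · simpa [add_comm] using (NKdV.psGraded_symW n).loopHasWeight 1 j
  -- `P_{-j}` is the coefficient of index `j + 1` of `symW`, so `1 ≤ j` is exactly the range `2 ≤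
  -- m`.
  · rw [NKdV.coeffMat_shiftLoop, if_pos (by omega)]
    exact NKdV.constantCoeff_symW hn _ (by omega) i k
  · rw [NKdV.shiftLoop_pow]
    exact ((NKdV.psGraded_symW n).pow l).loopHasWeight l
  · simpa using hpow U u M hU hu h x hx 1 j
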